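/- Let $n\ge 2$ and let $G_n$ be the straight linear 2-tree on $n$ vertices, i.e. the simple graph with vertex set $\{1,\dots,n\}$ in which $i$ and $j$ are adjacent if and only if $0<|i-j|\le 2$. Put a unit resistance on every edge, and let $r(i,j)$ be the resistance distance between vertices $i$ and $j$: $r(i,j)=v_i-v_j$ for any $v\in\mathbb{R}^n$ with $L v=e_i-e_j$, where $L$ is the Laplacian matrix of $G_n$. Let $F_k$ and $L_k$ be the Fibonacci and Lucas numbers ($F_0=0$, $F_1=1$; $L_0=2$, $L_1=1$). Then the minimal resistance distance between two distinct vertices of $G_n$ is \[ r\Big(\frac n2,\frac n2+1\Big)=\frac{F_{n-1}}{L_{n-1}}\qquad\text{if } n \text{ is even}, \] \[ r\Big(\frac{n-1}2,\frac{n+1}2\Big)=r\Big(\frac{n+1}2,\frac{n+3}2\Big)=\frac{F_{n-1}}{L_{n-1}}+\frac{1}{F_{2n-2}}\qquad\text{if } n \text{ is odd}. \] -/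

import Mathlib

open Matrix

/-- The Lucas numbers: `L 0 = 2`, `L 1 = 1`, `L (k + 2) = L k + L (k + 1)`. -/
def lucas : ℕ → ℕ
  | 0 => 2
  | 1 => 1
  | k + 2 => lucas k + lucas (k + 1)

namespace SimpleGraph

variable {V : Type*} [Fintype V] [DecidableEq V]

/-- `v` is a vector of potentials (voltages) on the electrical network obtained from `G` by putting
a unit resistance on each edge, when one unit of current flows into node `i` and one unit of
current flows out of node `j`: by the laws of Kirchhoff and Ohm, `L(G) v = e_i - e_j`, where
`L(G)` is the Laplacian matrix. -/
def IsUnitFlowPotential (G : SimpleGraph V) [DecidableRel G.Adj] (i j : V) (v : V → ℝ) : Prop :=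
  G.lapMatrix ℝ *ᵥ v = Pi.single i 1 - Pi.single j 1

open Classical in
/-- The resistance distance (effective resistance) between `i` and `j` in `G` with unit resistances
on the edges: the potential difference `v i - v j` for a potential `v` of the unit flow from `i`
to `j` (and the conventional value `0` if there is no such potential, which does not happen if
`i` and `j` lie in the same connected component). It does not depend on the choice of `v`, see
`resistanceDist_eq`. -/
noncomputable def resistanceDist (G : SimpleGraph V) [DecidableRel G.Adj] (i j : V) : ℝ :=
  if h : ∃ v, G.IsUnitFlowPotential i j v then h.choose i - h.choose j else 0

theorem resistanceDist_eq (G : SimpleGraph V) [DecidableRel G.Adj] {i j : V} {v : V → ℝ}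
    (hv : G.IsUnitFlowPotential i j v) : G.resistanceDist i j = v i - v j := by
  have h : ∃ v, G.IsUnitFlowPotential i j v := ⟨v, hv⟩
  rw [resistanceDist, dif_pos h]
  have hu : G.IsUnitFlowPotential i j h.choose := h.choose_spec
  generalize h.choose = u at hu
  unfold IsUnitFlowPotential at hu hv
  have key : u ⬝ᵥ (G.lapMatrix ℝ *ᵥ v) = v ⬝ᵥ (G.lapMatrix ℝ *ᵥ u) := by
    rw [dotProduct_mulVec, ← mulVec_transpose, (G.isSymm_lapMatrix (R := ℝ)).eq, dotProduct_comm]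
  rw [hu, hv] at key
  simpa [dotProduct_sub] using key

end SimpleGraph

/-- The straight linear 2-tree on `n` vertices. The vertex labelled `a ∈ {1, …, n}` is the element
`a - 1` of `Fin n`; two vertices are adjacent iff their labels differ by `1` or `2`. -/
def straightLinearTwoTree (n : ℕ) : SimpleGraph (Fin n) where
  Adj i j := i ≠ j ∧ (i : ℕ) ≤ (j : ℕ) + 2 ∧ (j : ℕ) ≤ (i : ℕ) + 2
  symm := ⟨fun _ _ h => ⟨h.1.symm, h.2.2, h.2.1⟩⟩
  loopless := ⟨fun _ h => h.1 rfl⟩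

instance straightLinearTwoTree.decidableAdj (n : ℕ) : DecidableRel (straightLinearTwoTree n).Adj := fun i j =>
  inferInstanceAs (Decidable (i ≠ j ∧ (i : ℕ) ≤ (j : ℕ) + 2 ∧ (j : ℕ) ≤ (i : ℕ) + 2))

/-- The vertex with label `a ∈ {1, …, n}` of the straight linear 2-tree on `n` vertices. -/
def vertexLabelled (n a : ℕ) (h : 1 ≤ a ∧ a ≤ n) : Fin n := ⟨a - 1, by omega⟩

/-! With `n = i + m + 2`, the flow between the consecutive vertices `i`, `i + 1` of `Fin n` is
solved explicitly: the resistance is `F_{2i+1} F_{2m+1} / F_{2n-2}`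
(`straightLinearTwoTree_resistanceDist_succ`). By Catalan's identity (`fib_odd_mul_fib_odd`) the
numerator is `F_{n-1}^2 + F_d^2` with `d = |i - m|`. Since `d` has the parity of `n`, this is least
for `d = 0` or `d = 1`, at the middle of the tree, and `F_{2N} = F_N L_N` gives the stated form.

For vertices further apart no exact value is needed: Dirichlet's principle with a short ramp gives
at least `1/2`, which for `n ≥ 4` is no less than the claimed minimum. The triangle `n = 3` needs
the sharper bound `2/3`. -/

namespace SimpleGraph

variable {V : Type*} [Fintype V] [DecidableEq V] {G : SimpleGraph V} [DecidableRel G.Adj]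

theorem IsUnitFlowPotential.neg {i j : V} {v : V → ℝ} (h : G.IsUnitFlowPotential i j v) :
    G.IsUnitFlowPotential j i (-v) := by
  unfold IsUnitFlowPotential at *
  rw [mulVec_neg, h, neg_sub]

theorem IsUnitFlowPotential.add {i j k : V} {v w : V → ℝ} (h : G.IsUnitFlowPotential i j v)
    (h' : G.IsUnitFlowPotential j k w) : G.IsUnitFlowPotential i k (v + w) := by
  unfold IsUnitFlowPotential at *
  rw [mulVec_add, h, h', sub_add_sub_cancel]

theorem IsUnitFlowPotential.resistanceDist_comm {i j : V} {v : V → ℝ}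
    (h : G.IsUnitFlowPotential i j v) : G.resistanceDist j i = G.resistanceDist i j := by
  rw [resistanceDist_eq G h, resistanceDist_eq G h.neg]
  simp only [Pi.neg_apply]
  ring

/-- Dirichlet's principle: a test function of energy at most `e` bounds the resistance distance
from below. -/
theorem IsUnitFlowPotential.sq_div_le_resistanceDist {i j : V} {v : V → ℝ}
    (h : G.IsUnitFlowPotential i j v) (f : V → ℝ) {e : ℝ} (ha : f i - f j ≠ 0)
    (he : f ⬝ᵥ (G.lapMatrix ℝ *ᵥ f) ≤ e) : (f i - f j) ^ 2 / e ≤ G.resistanceDist i j := by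
  rw [resistanceDist_eq G h]
  unfold IsUnitFlowPotential at h
  have psd : ∀ g : V → ℝ, 0 ≤ g ⬝ᵥ (G.lapMatrix ℝ *ᵥ g) := fun g => by
    simpa using (posSemidef_lapMatrix ℝ G).dotProduct_mulVec_nonneg g
  have hfv : f ⬝ᵥ (G.lapMatrix ℝ *ᵥ v) = f i - f j := by
    rw [h]; simp [dotProduct_sub]
  have hvv : v ⬝ᵥ (G.lapMatrix ℝ *ᵥ v) = v i - v j := by
    rw [h]; simp [dotProduct_sub]
  have hvf : v ⬝ᵥ (G.lapMatrix ℝ *ᵥ f) = f i - f j := by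
    rw [dotProduct_mulVec, ← mulVec_transpose, (G.isSymm_lapMatrix (R := ℝ)).eq, dotProduct_comm,
      hfv]
  set a := f i - f j with ha'
  -- The energy of `f - t • v` is nonnegative.
  have key : ∀ t : ℝ, 0 ≤ e - 2 * t * a + t ^ 2 * (v i - v j) := fun t => by
    have h0 := psd (f - t • v)
    simp only [mulVec_sub, mulVec_smul, dotProduct_sub, sub_dotProduct, smul_dotProduct,
      dotProduct_smul, smul_eq_mul, hfv, hvv, hvf] at h0
    linarith
  have he0 : 0 ≤ e := (psd f).trans he
  rcases he0.eq_or_lt with h0 | hpos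
  -- The quotient by `e = 0` is `0` by convention, so nonnegativity of the resistance is enough.
  · rw [← h0, div_zero, ← hvv]
    exact psd v
  -- Choosing `t = e / a` rather than the minimiser `a / (v i - v j)` avoids knowing that the
  -- resistance is nonzero.
  · have h1 := key (e / a)
    have h2 : e - 2 * (e / a) * a + (e / a) ^ 2 * (v i - v j)
        = (e ^ 2 * (v i - v j) - e * a ^ 2) / a ^ 2 := by
      field_simp
      ring
    rw [h2] at h1
    have h3 : 0 ≤ e ^ 2 * (v i - v j) - e * a ^ 2 := by
      by_contra hc
      exact absurd h1 (not_le.mpr (div_neg_of_neg_of_pos (not_le.mp hc) (by positivity)))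
    rw [div_le_iff₀ hpos]
    nlinarith

end SimpleGraph

/-! ### The Laplacian of the straight linear 2-tree in coordinates -/

/-- A sum over the vertices adjacent to `y`, as a sum over its at most four neighbours. -/
theorem straightLinearTwoTree_adj_ite {n : ℕ} (y z : Fin n) (c : ℝ) :
    (if (straightLinearTwoTree n).Adj y z then c else 0) =
      (if (z : ℕ) = y + 1 then c else 0) + (if (z : ℕ) = y + 2 then c else 0) +
      (if (y : ℕ) = z + 1 then c else 0) + (if (y : ℕ) = z + 2 then c else 0) := by
  have h : (straightLinearTwoTree n).Adj y z ↔
      (y : ℕ) ≠ z ∧ (y : ℕ) ≤ z + 2 ∧ (z : ℕ) ≤ y + 2 := by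
    simp [straightLinearTwoTree, Fin.ext_iff]
  simp only [h]
  split_ifs <;> first | omega | simp

theorem Fin.sum_ite_val_eq {n : ℕ} (k : ℕ) (g : ℕ → ℝ) :
    ∑ z : Fin n, (if (z : ℕ) = k then g z else 0) = if k < n then g k else 0 := by
  rw [Fin.sum_univ_eq_sum_range (fun z => if z = k then g z else 0) n]
  simp [Finset.sum_ite_eq']

theorem straightLinearTwoTree_lapMatrix_mulVec {n : ℕ} (g : ℕ → ℝ) (y : Fin n) :
    ((straightLinearTwoTree n).lapMatrix ℝ *ᵥ (fun z : Fin n => g z)) y =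
      (if (y : ℕ) + 1 < n then g y - g (y + 1) else 0) +
      (if (y : ℕ) + 2 < n then g y - g (y + 2) else 0) +
      (if 1 ≤ (y : ℕ) then g y - g (y - 1) else 0) +
      (if 2 ≤ (y : ℕ) then g y - g (y - 2) else 0) := by
  have h1 : ((straightLinearTwoTree n).lapMatrix ℝ *ᵥ (fun z : Fin n => g z)) y =
      ∑ z : Fin n, if (straightLinearTwoTree n).Adj y z then g y - g z else 0 := by
    rw [SimpleGraph.lapMatrix_mulVec_apply, ← Finset.sum_filter,
      ← SimpleGraph.neighborFinset_eq_filter, Finset.sum_sub_distrib]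
    simp
  rw [h1]
  simp only [straightLinearTwoTree_adj_ite, Finset.sum_add_distrib]
  have h3 (k : ℕ) (hk : 0 < k) : ∑ z : Fin n, (if (y : ℕ) = z + k then g y - g z else 0) =
      if k ≤ (y : ℕ) then g y - g (y - k) else 0 := by
    by_cases hky : k ≤ (y : ℕ)
    · rw [if_pos hky, Finset.sum_congr rfl (g := fun z : Fin n =>
        if (z : ℕ) = y - k then g y - g z else 0)
        (fun z _ => by congr 1; simp only [eq_iff_iff]; omega),
        Fin.sum_ite_val_eq (y - k) (fun z => g y - g z), if_pos (by omega)]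
    · rw [if_neg hky]
      exact Finset.sum_eq_zero fun z _ => if_neg (by omega)
  rw [Fin.sum_ite_val_eq (y + 1) (fun z => g y - g z),
    Fin.sum_ite_val_eq (y + 2) (fun z => g y - g z), h3 1 one_pos, h3 2 two_pos]

theorem straightLinearTwoTree_energy {n : ℕ} (g : ℕ → ℝ) :
    (fun z : Fin n => g z) ⬝ᵥ ((straightLinearTwoTree n).lapMatrix ℝ *ᵥ (fun z : Fin n => g z)) =
      ∑ y ∈ Finset.range n, ((if y + 1 < n then (g (y + 1) - g y) ^ 2 else 0) +
        (if y + 2 < n then (g (y + 2) - g y) ^ 2 else 0)) := by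
  have h0 := (straightLinearTwoTree n).lapMatrix_toLinearMap₂' ℝ (fun z : Fin n => g z)
  rw [Matrix.toLinearMap₂'_apply'] at h0
  rw [h0]
  simp only [straightLinearTwoTree_adj_ite, Finset.sum_add_distrib]
  have h1 (k : ℕ) : ∑ y : Fin n, ∑ z : Fin n,
      (if (z : ℕ) = y + k then (g y - g z) ^ 2 else 0) =
      ∑ y ∈ Finset.range n, if y + k < n then (g (y + k) - g y) ^ 2 else 0 := by
    rw [← Fin.sum_univ_eq_sum_range
      (fun y => if y + k < n then (g (y + k) - g y) ^ 2 else 0) n]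
    refine Finset.sum_congr rfl fun y _ => ?_
    rw [Fin.sum_ite_val_eq (y + k) (fun z => (g y - g z) ^ 2)]
    congr 1
    ring
  have h2 (k : ℕ) : ∑ y : Fin n, ∑ z : Fin n,
      (if (y : ℕ) = z + k then (g y - g z) ^ 2 else 0) =
      ∑ y ∈ Finset.range n, if y + k < n then (g (y + k) - g y) ^ 2 else 0 := by
    rw [← h1, Finset.sum_comm]
    refine Finset.sum_congr rfl fun y _ => Finset.sum_congr rfl fun z _ => ?_
    congr 1
    ring
  rw [h1, h1, h2, h2]
  ring

/-! ### Explicit potentials for consecutive vertices -/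

/-- Kirchhoff's current law in terms of the currents through the cuts `{0, …, x} | {x + 1, …}`. -/
theorem straightLinearTwoTree_isUnitFlowPotential_of_cut {n i : ℕ} (hi : i + 1 < n) (d : ℕ → ℝ)
    (hd : ∀ x, x < n → ((if x + 1 < n then d x else 0) +
      (if x + 2 < n then d x + d (x + 1) else 0) +
      (if 1 ≤ x ∧ x + 1 < n then d (x - 1) + d x else 0)) = if x = i then 1 else 0) :
    (straightLinearTwoTree n).IsUnitFlowPotential ⟨i, by omega⟩ ⟨i + 1, hi⟩
      (fun z => -∑ t ∈ Finset.range z, d t) := by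
  unfold SimpleGraph.IsUnitFlowPotential
  funext y
  rw [straightLinearTwoTree_lapMatrix_mulVec (fun z => -∑ t ∈ Finset.range z, d t)]
  obtain ⟨y, hy⟩ := y
  have hs : (Pi.single (⟨i, by omega⟩ : Fin n) (1 : ℝ) - Pi.single (⟨i + 1, hi⟩ : Fin n) (1 : ℝ) :
      Fin n → ℝ) ⟨y, hy⟩ = (if y = i then 1 else 0) - (if y = i + 1 then 1 else 0) := by
    simp [Pi.single_apply]
  rw [hs]
  -- The current law at `y` is the cut equation at `y` minus the one at `y - 1`. Vertices `0` and
  -- `1` are separate because they lack some of the lower neighbours.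
  rcases y with _ | _ | y
  · have h0 := hd 0 hy
    simp only [Finset.sum_range_succ, Finset.sum_range_zero] at h0 ⊢
    norm_num at h0 ⊢
    linarith
  · have h0 := hd 0 (by omega)
    have h1 := hd 1 hy
    simp only [Finset.sum_range_succ, Finset.sum_range_zero] at h0 h1 ⊢
    norm_num at h0 h1 hy ⊢
    simp only [hy, if_true, eq_comm (a := 0) (b := i)] at h0 h1 ⊢
    simp only [eq_comm (a := i) (b := 0)] at h0 h1 ⊢
    split_ifs at h0 h1 ⊢ <;> first | omega | linarith
  · have h0 := hd (y + 1) (by omega)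
    have h1 := hd (y + 2) (by omega)
    simp only [Finset.sum_range_succ, Nat.add_sub_cancel, show y + 1 + 1 = y + 2 from rfl,
      show y + 2 - 1 = y + 1 from rfl,
      show y + 1 + 2 = y + 3 from rfl, show y + 2 + 2 = y + 4 from rfl] at h0 h1 ⊢
    split_ifs at h0 h1 ⊢ <;> first | omega | linarith

/-- The (unnormalised) potential differences along a straight linear 2-tree seen from its end. -/
noncomputable def alternatingOddFib (x : ℕ) : ℝ := (-1) ^ x * (Nat.fib (2 * x + 1) : ℝ)

theorem alternatingOddFib_add_succ (x : ℕ) :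
    alternatingOddFib x + alternatingOddFib (x + 1) =
      (-1) ^ (x + 1) * (Nat.fib (2 * (x + 1)) : ℝ) := by
  have h : (Nat.fib (2 * (x + 1) + 1) : ℝ) = Nat.fib (2 * x + 1) + Nat.fib (2 * (x + 1)) := by
    exact_mod_cast Nat.fib_add_two (n := 2 * x + 1)
  unfold alternatingOddFib
  rw [h, pow_succ]
  ring

/-- This says that no net current crosses a cut away from source and sink; the last two terms stand
for the two edges of length 2 across it. At the end of the tree, `F_0 = 0` accounts for the missing
edge. -/
theorem alternatingOddFib_eq (x : ℕ) :
    alternatingOddFib x + (-1) ^ (x + 1) * (Nat.fib (2 * (x + 1)) : ℝ) +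
      (-1) ^ x * (Nat.fib (2 * x) : ℝ) = 0 := by
  have h : (Nat.fib (2 * (x + 1)) : ℝ) = Nat.fib (2 * x) + Nat.fib (2 * x + 1) := by
    exact_mod_cast Nat.fib_add_two (n := 2 * x)
  unfold alternatingOddFib
  rw [h, pow_succ]
  ring

/-- Computes the current through the cut between source and sink, hence the factor that normalises
it to one. -/
theorem alternatingOddFib_mul (i m : ℕ) :
    alternatingOddFib i * alternatingOddFib m +
      (-1) ^ i * (Nat.fib (2 * i) : ℝ) * alternatingOddFib m +
      alternatingOddFib i * ((-1) ^ m * (Nat.fib (2 * m) : ℝ)) =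
      (-1) ^ (i + m) * (Nat.fib (2 * (i + m + 1)) : ℝ) := by
  have h : (Nat.fib (2 * (i + m + 1)) : ℝ) = Nat.fib (2 * i) * Nat.fib (2 * m + 1) +
      Nat.fib (2 * i + 1) * (Nat.fib (2 * m) + Nat.fib (2 * m + 1)) := by
    have h1 := Nat.fib_add (2 * i) (2 * m + 1)
    rw [show 2 * i + (2 * m + 1) + 1 = 2 * (i + m + 1) by ring,
      show 2 * m + 1 + 1 = 2 * m + 2 from rfl, Nat.fib_add_two] at h1
    exact_mod_cast h1
  unfold alternatingOddFib
  rw [h, pow_add]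
  ring

theorem straightLinearTwoTree_exists_potential_succ (i m : ℕ) :
    ∃ v, (straightLinearTwoTree (i + m + 2)).IsUnitFlowPotential ⟨i, by omega⟩ ⟨i + 1, by omega⟩ v ∧
      v ⟨i, by omega⟩ - v ⟨i + 1, by omega⟩ =
        (Nat.fib (2 * i + 1) * Nat.fib (2 * m + 1) : ℝ) / Nat.fib (2 * (i + m + 1)) := by
  set p := alternatingOddFib with hp
  set D : ℝ := (-1) ^ (i + m) * (Nat.fib (2 * (i + m + 1)) : ℝ) with hD
  have hF : (Nat.fib (2 * (i + m + 1)) : ℝ) ≠ 0 := by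
    exact_mod_cast (Nat.fib_pos.mpr (by omega)).ne'
  have hD0 : D ≠ 0 := mul_ne_zero (pow_ne_zero _ (by norm_num)) hF
  -- The solutions seen from the two ends are glued at `x = i`, where both formulas give `p i * p
  -- m`.
  set d : ℕ → ℝ := fun x => (if x ≤ i then p x * p m else p i * p (i + m - x)) / D with hd
  have hleft : ∀ x, x ≤ i → d x = p x * p m / D := fun x hx => by simp [hd, hx]
  have hright : ∀ s t, s + t = m → d (i + s) = p i * p t / D := fun s t hst => by
    rcases s with _ | s
    · simp [hd, show t = m by omega]
    · simp [hd, show i + m - (i + (s + 1)) = t by omega]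
  refine ⟨_, straightLinearTwoTree_isUnitFlowPotential_of_cut (by omega) d ?_, ?_⟩
  · have hl : ∀ x, x ≤ i → (if 1 ≤ x ∧ x + 1 < i + m + 2 then d (x - 1) + d x else 0) =
        (-1) ^ x * (Nat.fib (2 * x) : ℝ) * p m / D := fun x hx => by
      rcases x with _ | x
      · simp
      · rw [if_pos (by omega), Nat.add_sub_cancel, hleft _ hx, hleft _ (by omega),
          ← alternatingOddFib_add_succ]
        ring
    have hr : ∀ s t, s + t = m → (if i + s + 2 < i + m + 2 then d (i + s) + d (i + s + 1) else 0) =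
        p i * ((-1) ^ t * (Nat.fib (2 * t) : ℝ)) / D := fun s t hst => by
      rcases t with _ | t
      · simp [show s = m by omega]
      · rw [if_pos (by omega), hright s (t + 1) hst, add_assoc, hright (s + 1) t (by omega),
          ← alternatingOddFib_add_succ]
        ring
    intro x hx
    rcases lt_trichotomy x i with h | h | h
    · rw [hl x h.le, if_pos (by omega), if_pos (by omega), if_neg h.ne, hleft x h.le,
        hleft (x + 1) h]
      have h1 := alternatingOddFib_eq x
      rw [← alternatingOddFib_add_succ] at h1
      calc _ = (p x + (p x + p (x + 1)) + (-1) ^ x * (Nat.fib (2 * x) : ℝ)) * p m / D := by ring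
        _ = 0 := by rw [hp, h1]; ring
    · subst h
      have h1 := hr 0 m (by omega)
      rw [add_zero] at h1
      rw [hl x le_rfl, h1, if_pos (by omega), if_pos rfl, hleft x le_rfl]
      have h2 := alternatingOddFib_mul x m
      rw [← hD, ← hp] at h2
      field_simp
      linarith
    -- At the last vertex nothing lies beyond the cut, so the equation is empty.
    · by_cases hx' : x = i + m + 1
      · subst hx'
        simp
        omega
      · obtain ⟨s, rfl⟩ : ∃ s, x = i + (s + 1) := ⟨x - i - 1, by omega⟩
        obtain ⟨t, rfl⟩ : ∃ t, m = s + 1 + t := ⟨m - (s + 1), by omega⟩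
        rw [hr (s + 1) t rfl, if_pos (by omega), if_pos (by omega), if_neg (by omega),
          hright (s + 1) t rfl, show i + (s + 1) - 1 = i + s by omega,
          hright s (t + 1) (by omega)]
        have h1 := alternatingOddFib_eq t
        rw [← alternatingOddFib_add_succ] at h1
        calc _ = (p t + (p t + p (t + 1)) + (-1) ^ t * (Nat.fib (2 * t) : ℝ)) * p i / D := by ring
          _ = 0 := by rw [hp, h1]; ring
  · simp only [Finset.sum_range_succ]
    have h1 : p i * p m = (-1) ^ (i + m) * (Nat.fib (2 * i + 1) * Nat.fib (2 * m + 1) : ℝ) := by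
      simp only [hp, alternatingOddFib, pow_add]
      ring
    rw [hleft i le_rfl, h1, hD, mul_div_mul_left _ _ (pow_ne_zero _ (by norm_num))]
    ring

theorem straightLinearTwoTree_resistanceDist_succ {n : ℕ} (i m : ℕ) (hn : n = i + m + 2) :
    (straightLinearTwoTree n).resistanceDist ⟨i, by omega⟩ ⟨i + 1, by omega⟩ =
      (Nat.fib (2 * i + 1) * Nat.fib (2 * m + 1) : ℝ) / Nat.fib (2 * (i + m + 1)) := by
  subst hn
  obtain ⟨v, hv, h⟩ := straightLinearTwoTree_exists_potential_succ i m
  rw [SimpleGraph.resistanceDist_eq _ hv, h]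

/-- Unit flows between consecutive vertices superpose. Existence matters because `resistanceDist`
would otherwise take its default value `0`. -/
theorem straightLinearTwoTree_exists_potential {n i : ℕ} (k : ℕ) (h : i + k + 1 < n) :
    ∃ v, (straightLinearTwoTree n).IsUnitFlowPotential ⟨i, by omega⟩ ⟨i + k + 1, h⟩ v := by
  have hsucc : ∀ i (hi : i + 1 < n), ∃ v,
      (straightLinearTwoTree n).IsUnitFlowPotential ⟨i, Nat.lt_of_succ_lt hi⟩ ⟨i + 1, hi⟩ v := by
    clear h
    intro i hi
    obtain ⟨m, rfl⟩ : ∃ m, n = i + m + 2 := ⟨n - i - 2, by omega⟩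
    obtain ⟨v, hv, -⟩ := straightLinearTwoTree_exists_potential_succ i m
    exact ⟨v, hv⟩
  induction k with
  | zero => exact hsucc i h
  | succ k ih =>
    obtain ⟨v, hv⟩ := ih (by omega)
    obtain ⟨w, hw⟩ := hsucc (i + k + 1) h
    exact ⟨_, hv.add hw⟩

/-! ### Lower bounds for non-consecutive vertices -/

/-- The energy of a ramp from `i` to `i + k` in a straight linear 2-tree. -/
theorem straightLinearTwoTree_ramp_energy_le {n : ℕ} (i k : ℕ) :
    (fun z : Fin n => ((min ((z : ℕ) - i) (k + 2) : ℕ) : ℝ)) ⬝ᵥ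
      ((straightLinearTwoTree n).lapMatrix ℝ *ᵥ
        (fun z : Fin n => ((min ((z : ℕ) - i) (k + 2) : ℕ) : ℝ))) ≤ 5 * k + 8 := by
  rw [straightLinearTwoTree_energy (fun z => ((min (z - i) (k + 2) : ℕ) : ℝ))]
  -- Each edge is charged to its lower endpoint. A vertex on the slope pays at most `1 + 4`, the
  -- vertex before the ramp `1`, and the last one below the plateau `1 + 1`, whence `5 * (k + 1) +
  -- 3`.
  have hle : ∀ y ∈ Finset.range n,
      (if y + 1 < n then (((min (y + 1 - i) (k + 2) : ℕ) : ℝ) - (min (y - i) (k + 2) : ℕ)) ^ 2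
        else 0) +
      (if y + 2 < n then (((min (y + 2 - i) (k + 2) : ℕ) : ℝ) - (min (y - i) (k + 2) : ℕ)) ^ 2
        else 0) ≤
      (if i = y + 1 then (1 : ℝ) else 0) + (if y ∈ Finset.Ico i (i + k + 1) then 5 else 0) +
        (if y = i + k + 1 then 2 else 0) := by
    intro y _
    have hnn : ∀ (P : Prop) [Decidable P] (a : ℝ), (if P then a ^ 2 else 0) ≤ a ^ 2 :=
      fun P _ a => by
        split_ifs
        · exact le_rfl
        · positivity
    refine (add_le_add (hnn _ _) (hnn _ _)).trans ?_
    simp only [Finset.mem_Ico]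
    rcases lt_or_ge (y + 1) i with h | h
    · rw [show y + 1 - i = 0 by omega, show y + 2 - i = 0 by omega, show y - i = 0 by omega]
      split_ifs <;> norm_num
    rcases h.eq_or_lt with h | h
    · rw [show y + 1 - i = 0 by omega, show y + 2 - i = 1 by omega, show y - i = 0 by omega,
        if_pos h, if_neg (by omega), if_neg (by omega), show min 1 (k + 2) = 1 by omega]
      norm_num
    obtain ⟨s, rfl⟩ : ∃ s, y = i + s := ⟨y - i, by omega⟩
    rw [show i + s + 1 - i = s + 1 by omega, show i + s + 2 - i = s + 2 by omega,
      show i + s - i = s by omega, if_neg (by omega)]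
    rcases lt_trichotomy s (k + 1) with h1 | h1 | h1
    · rw [if_pos (by omega), if_neg (by omega), min_eq_left (by omega), min_eq_left (by omega),
        min_eq_left (by omega)]
      push_cast
      ring_nf
      norm_num
    · subst h1
      rw [if_neg (by omega), if_pos (by omega), min_eq_left (by omega), min_eq_left (by omega),
        min_eq_right (by omega)]
      push_cast
      ring_nf
      norm_num
    · rw [min_eq_right (by omega), min_eq_right (by omega), min_eq_right (by omega)]
      split_ifs <;> norm_num
  refine (Finset.sum_le_sum hle).trans ?_
  rw [Finset.sum_add_distrib, Finset.sum_add_distrib]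
  have h1 : ∑ y ∈ Finset.range n, (if i = y + 1 then (1 : ℝ) else 0) ≤ 1 := by
    rcases i with _ | i
    · simp
    · simp only [add_left_inj, Finset.sum_ite_eq]
      split_ifs <;> norm_num
  have h2 : ∑ y ∈ Finset.range n, (if y ∈ Finset.Ico i (i + k + 1) then (5 : ℝ) else 0) ≤
      5 * (k + 1) := by
    rw [← Finset.sum_filter, Finset.sum_const, nsmul_eq_mul, mul_comm]
    have : (Finset.filter (fun y => y ∈ Finset.Ico i (i + k + 1)) (Finset.range n)).card ≤ k + 1 := by
      refine (Finset.card_le_card (t := Finset.Ico i (i + k + 1)) fun y hy => ?_).trans ?_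
      · exact (Finset.mem_filter.mp hy).2
      · rw [Nat.card_Ico]; omega
    have : ((Finset.filter (fun y => y ∈ Finset.Ico i (i + k + 1)) (Finset.range n)).card : ℝ) ≤
      k + 1 := by exact_mod_cast this
    linarith
  have h3 : ∑ y ∈ Finset.range n, (if y = i + k + 1 then (2 : ℝ) else 0) ≤ 2 := by
    rw [Finset.sum_ite_eq']
    split_ifs <;> norm_num
  linarith

theorem straightLinearTwoTree_half_le_resistanceDist {n i j : ℕ} (hij : i + 2 ≤ j) (hj : j < n) :
    1 / 2 ≤ (straightLinearTwoTree n).resistanceDist ⟨i, by omega⟩ ⟨j, hj⟩ := by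
  obtain ⟨v, hv⟩ : ∃ v, (straightLinearTwoTree n).IsUnitFlowPotential ⟨i, by omega⟩ ⟨j, hj⟩ v := by
    obtain ⟨k, rfl⟩ : ∃ k, j = i + k + 1 := ⟨j - i - 1, by omega⟩
    exact straightLinearTwoTree_exists_potential k hj
  -- The ramp rises by `2` with energy at most `8`, giving `4 / 8`.
  have h := hv.sq_div_le_resistanceDist
    (fun z : Fin n => ((min ((z : ℕ) - i) (0 + 2) : ℕ) : ℝ)) ?_
    (straightLinearTwoTree_ramp_energy_le i 0)
  · refine le_trans ?_ h
    simp only [Nat.sub_self, min_eq_right (show 0 + 2 ≤ j - i by omega)]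
    norm_num
  · simp only [Nat.sub_self, min_eq_right (show 0 + 2 ≤ j - i by omega)]
    norm_num

theorem straightLinearTwoTree_three_resistanceDist_zero_two :
    2 / 3 ≤ (straightLinearTwoTree 3).resistanceDist 0 2 := by
  obtain ⟨v, hv⟩ := straightLinearTwoTree_exists_potential (n := 3) (i := 0) 1 (by omega)
  have h := hv.sq_div_le_resistanceDist (fun z : Fin 3 => ((z : ℕ) : ℝ)) (e := 6) (by norm_num)
    (by
      rw [straightLinearTwoTree_energy (fun z => (z : ℝ))]
      norm_num [Finset.sum_range_succ])
  refine le_trans ?_ h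
  norm_num

/-! ### Fibonacci and Lucas identities -/

theorem lucas_add_fib (n : ℕ) : lucas n + Nat.fib n = 2 * Nat.fib (n + 1) := by
  induction n using Nat.twoStepInduction with
  | zero => rfl
  | one => rfl
  | more n h1 h2 =>
    have h3 := Nat.fib_add_two (n := n)
    have h4 := Nat.fib_add_two (n := n + 1)
    simp only [lucas, Nat.add_assoc, Nat.reduceAdd] at *
    omega

theorem fib_two_mul_eq_fib_mul_lucas (n : ℕ) : Nat.fib (2 * n) = Nat.fib n * lucas n := by
  rw [Nat.fib_two_mul, ← lucas_add_fib, Nat.add_sub_cancel]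

theorem fib_two_mul_add_one_sq (k : ℕ) : Nat.fib (2 * k + 1) ^ 2 =
    Nat.fib (2 * k) * Nat.fib (2 * k + 1) + Nat.fib (2 * k) ^ 2 + 1 := by
  induction k with
  | zero => rfl
  | succ k ih =>
    have h1 := Nat.fib_add_two (n := 2 * k)
    have h2 := Nat.fib_add_two (n := 2 * k + 1)
    rw [show 2 * (k + 1) = 2 * k + 2 by ring, h2, show 2 * k + 1 + 1 = 2 * k + 2 from rfl, h1]
    nlinarith

/-- Catalan's identity for odd indices. -/
theorem fib_odd_mul_fib_odd (k d : ℕ) :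
    Nat.fib (2 * k + 1) * Nat.fib (2 * (k + d) + 1) =
      Nat.fib (2 * k + d + 1) ^ 2 + Nat.fib d ^ 2 := by
  have h0 := fib_two_mul_add_one_sq k
  have h1 := Nat.fib_add (2 * k) d
  have h2 := Nat.fib_add (2 * k) (2 * d)
  have h3 : Nat.fib (2 * d) + Nat.fib d ^ 2 = 2 * Nat.fib d * Nat.fib (d + 1) := by
    rw [fib_two_mul_eq_fib_mul_lucas]
    nlinarith [lucas_add_fib d]
  rw [Nat.fib_two_mul_add_one d] at h2
  rw [h1, show 2 * (k + d) + 1 = 2 * k + 2 * d + 1 by ring, h2]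
  zify at *
  have h4 : (Nat.fib (2 * d) : ℤ) = 2 * Nat.fib d * Nat.fib (d + 1) - Nat.fib d ^ 2 := by linarith
  rw [h4]
  -- After the addition formulas, the two sides differ by `F_d^2` times Cassini's identity `h0`.
  linear_combination (Nat.fib d : ℤ) ^ 2 * h0

/-- In Catalan's identity the excess `F_d^2`, `d = |i - m|`, is at least `1` unless `d = 0`, and `d`
has the parity of `i + m`. -/
theorem sq_fib_add_le_fib_odd_mul_fib_odd (i m : ℕ) :
    Nat.fib (i + m + 1) ^ 2 + (i + m) % 2 ≤ Nat.fib (2 * i + 1) * Nat.fib (2 * m + 1) := by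
  wlog h : i ≤ m generalizing i m
  · have := this m i (by omega)
    rwa [add_comm m i, mul_comm] at this
  obtain ⟨d, rfl⟩ := Nat.exists_eq_add_of_le h
  rw [fib_odd_mul_fib_odd, show i + (i + d) = 2 * i + d by ring]
  have : (2 * i + d) % 2 ≤ Nat.fib d ^ 2 := by
    rcases d with _ | d
    · simp
    · have : 0 < Nat.fib (d + 1) ^ 2 := by positivity [Nat.fib_pos.mpr (Nat.succ_pos d)]
      omega
  omega

/-- Since `L_N = 2 F_N + F_{N-3}`, the surplus of `F_N L_N` over `2 F_N^2` is `F_N F_{N-3}`, which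
absorbs the parity term. Equality holds at `N = 3`. -/
theorem two_mul_sq_fib_add_le (N : ℕ) (hN : 3 ≤ N) :
    2 * (Nat.fib N ^ 2 + (N + 1) % 2) ≤ Nat.fib (2 * N) := by
  obtain ⟨k, rfl⟩ := Nat.exists_eq_add_of_le' hN
  have h1 := Nat.fib_add_two (n := k)
  have h2 := Nat.fib_add_two (n := k + 1)
  have h3 := Nat.fib_add_two (n := k + 2)
  have h4 := lucas_add_fib (k + 3)
  simp only [Nat.add_assoc, Nat.reduceAdd] at *
  have h5 : lucas (k + 3) = 2 * Nat.fib (k + 3) + Nat.fib k := by omega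
  rw [fib_two_mul_eq_fib_mul_lucas, h5]
  have h6 : 2 * ((k + 4) % 2) ≤ Nat.fib (k + 3) * Nat.fib k := by
    rcases k with _ | k
    · simp
    · have ha : 1 ≤ Nat.fib (k + 1) := Nat.fib_pos.mpr (by omega)
      have hb : 2 ≤ Nat.fib (k + 1 + 3) := by
        have : 1 ≤ Nat.fib (k + 1 + 1) := Nat.fib_pos.mpr (by omega)
        omega
      calc _ ≤ 2 * 1 := by omega
        _ ≤ _ := Nat.mul_le_mul hb ha
  nlinarith

/-! ### The minimum over all pairs -/

theorem straightLinearTwoTree_le_resistanceDist {n : ℕ} {i j : Fin n} (hij : i ≠ j) :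
    ((Nat.fib (n - 1) ^ 2 + n % 2 : ℕ) : ℝ) / Nat.fib (2 * (n - 1)) ≤
      (straightLinearTwoTree n).resistanceDist i j := by
  have main : ∀ {i j : ℕ} (h : i < j) (hj : j < n),
      ((Nat.fib (n - 1) ^ 2 + n % 2 : ℕ) : ℝ) / Nat.fib (2 * (n - 1)) ≤
        (straightLinearTwoTree n).resistanceDist ⟨i, by omega⟩ ⟨j, hj⟩ := by
    clear hij i j
    intro i j h hj
    have hpos : (0 : ℝ) < Nat.fib (2 * (n - 1)) := by
      exact_mod_cast Nat.fib_pos.mpr (by omega)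
    rcases (Nat.succ_le_of_lt h).eq_or_lt with rfl | h2
    · obtain ⟨m, rfl⟩ : ∃ m, n = i + m + 2 := ⟨n - i - 2, by omega⟩
      rw [straightLinearTwoTree_resistanceDist_succ i m rfl]
      have h3 := sq_fib_add_le_fib_odd_mul_fib_odd i m
      rw [show (i + m) % 2 = (i + m + 2) % 2 by omega] at h3
      exact div_le_div_of_nonneg_right (by exact_mod_cast h3) hpos.le
    -- For `n = 3` the claimed minimum is `2 / 3`, so the bound `1 / 2` is too weak there.
    rcases (show 3 ≤ n by omega).eq_or_lt with rfl | hn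
    · obtain ⟨rfl, rfl⟩ : i = 0 ∧ j = 2 := by omega
      refine le_trans (b := 2 / 3) ?_
        straightLinearTwoTree_three_resistanceDist_zero_two
      norm_num [Nat.fib_add_two]
    · refine le_trans ?_ (straightLinearTwoTree_half_le_resistanceDist h2 hj)
      have h3 := two_mul_sq_fib_add_le (n - 1) (by omega)
      rw [Nat.sub_add_cancel (by omega)] at h3
      rw [div_le_div_iff₀ hpos two_pos, mul_comm, one_mul]
      exact_mod_cast h3
  rcases lt_or_gt_of_ne hij with h | h
  · exact main h j.2
  · obtain ⟨k, hk⟩ : ∃ k, (i : ℕ) = j + k + 1 := ⟨i - j - 1, by omega⟩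
    obtain ⟨v, hv⟩ := straightLinearTwoTree_exists_potential (n := n) (i := j) k (hk ▸ i.2)
    have hi : (⟨j + k + 1, hk ▸ i.2⟩ : Fin n) = i := Fin.ext hk.symm
    rw [hi] at hv
    rw [hv.resistanceDist_comm]
    exact main h i.2

theorem fib_div_lucas (N : ℕ) :
    (Nat.fib N : ℝ) / lucas N = (Nat.fib N : ℝ) ^ 2 / Nat.fib (2 * N) := by
  rcases N with _ | N
  · simp
  · rw [fib_two_mul_eq_fib_mul_lucas]
    have h : (Nat.fib (N + 1) : ℝ) ≠ 0 := by exact_mod_cast (Nat.fib_pos.mpr N.succ_pos).ne'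
    push_cast
    rw [sq, mul_div_mul_left _ _ h]

theorem mainTheorem9 (n : ℕ) (hn : 2 ≤ n) :
    (Even n →
      (straightLinearTwoTree n).resistanceDist
          (vertexLabelled n (n / 2) (by omega)) (vertexLabelled n (n / 2 + 1) (by omega)) =
        (Nat.fib (n - 1) : ℝ) / (lucas (n - 1) : ℝ) ∧
      IsLeast {r : ℝ | ∃ i j : Fin n, i ≠ j ∧ r = (straightLinearTwoTree n).resistanceDist i j}
        ((Nat.fib (n - 1) : ℝ) / (lucas (n - 1) : ℝ))) ∧
    (∀ hodd : Odd n,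
      (straightLinearTwoTree n).resistanceDist
          (vertexLabelled n ((n - 1) / 2) (by obtain ⟨k, hk⟩ := hodd; omega))
          (vertexLabelled n ((n + 1) / 2) (by omega)) =
        (Nat.fib (n - 1) : ℝ) / (lucas (n - 1) : ℝ) + 1 / (Nat.fib (2 * n - 2) : ℝ) ∧
      (straightLinearTwoTree n).resistanceDist
          (vertexLabelled n ((n + 1) / 2) (by omega))
          (vertexLabelled n ((n + 3) / 2) (by obtain ⟨k, hk⟩ := hodd; omega)) =
        (Nat.fib (n - 1) : ℝ) / (lucas (n - 1) : ℝ) + 1 / (Nat.fib (2 * n - 2) : ℝ) ∧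
      IsLeast {r : ℝ | ∃ i j : Fin n, i ≠ j ∧ r = (straightLinearTwoTree n).resistanceDist i j}
        ((Nat.fib (n - 1) : ℝ) / (lucas (n - 1) : ℝ) + 1 / (Nat.fib (2 * n - 2) : ℝ))) := by
  have hbound : ∀ {r : ℝ}, r = ((Nat.fib (n - 1) ^ 2 + n % 2 : ℕ) : ℝ) / Nat.fib (2 * (n - 1)) →
      ∀ {i j : Fin n}, i ≠ j → (straightLinearTwoTree n).resistanceDist i j = r →
      IsLeast {r : ℝ | ∃ i j : Fin n, i ≠ j ∧ r = (straightLinearTwoTree n).resistanceDist i j}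
        r := by
    rintro r hr i j hij hrij
    refine ⟨⟨i, j, hij, hrij.symm⟩, ?_⟩
    rintro _ ⟨i', j', hij', rfl⟩
    rw [hr]
    exact straightLinearTwoTree_le_resistanceDist hij'
  have hres : ∀ (a b m : ℕ) (ha : 1 ≤ a ∧ a ≤ n) (hb : 1 ≤ b ∧ b ≤ n), b = a + 1 → n = a + m + 1 →
      (straightLinearTwoTree n).resistanceDist (vertexLabelled n a ha) (vertexLabelled n b hb) =
        ((Nat.fib (2 * (a - 1) + 1) * Nat.fib (2 * m + 1) : ℕ) : ℝ) / Nat.fib (2 * (n - 1)) := by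
    rintro a b m ⟨ha, ha'⟩ hb rfl hm
    obtain ⟨i, rfl⟩ := Nat.exists_eq_add_of_le' ha
    subst hm
    have h := straightLinearTwoTree_resistanceDist_succ (n := i + 1 + m + 1) i m (by omega)
    rw [show i + 1 + m + 1 - 1 = i + m + 1 by omega]
    push_cast
    exact h
  constructor
  · rintro ⟨k, rfl⟩
    obtain ⟨k, rfl⟩ := Nat.exists_eq_add_of_le' (show 1 ≤ k by omega)
    -- The middle edge has `k` vertices on each side, so the numerator is a perfect square.
    have h1 := hres ((k + 1 + (k + 1)) / 2) ((k + 1 + (k + 1)) / 2 + 1) k (by omega) (by omega) rfl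
      (by omega)
    rw [show (k + 1 + (k + 1)) / 2 - 1 = k by omega, show 2 * k + 1 = k + 1 + (k + 1) - 1 by omega,
      ← sq] at h1
    push_cast at h1
    rw [← fib_div_lucas] at h1
    refine ⟨h1, hbound ?_ ?_ h1⟩
    · rw [fib_div_lucas, show (k + 1 + (k + 1)) % 2 = 0 by omega, add_zero]
      push_cast
      rfl
    · simp [vertexLabelled, Fin.ext_iff]
      omega
  · rintro ⟨k, rfl⟩
    obtain ⟨k, rfl⟩ := Nat.exists_eq_add_of_le' (show 1 ≤ k by omega)
    have h1 := hres ((2 * (k + 1) + 1 - 1) / 2) ((2 * (k + 1) + 1 + 1) / 2) (k + 1) (by omega)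
      (by omega) (by omega) (by omega)
    have h2 := hres ((2 * (k + 1) + 1 + 1) / 2) ((2 * (k + 1) + 1 + 3) / 2) k (by omega)
      (by omega) (by omega) (by omega)
    -- Both middle edges have `k` and `k + 1` vertices on their two sides; the excess `F_1^2 = 1`
    -- yields the extra `1 / F_{2n-2}`.
    have h3 := fib_odd_mul_fib_odd k 1
    have h4 : (Nat.fib (2 * (k + 1) + 1 - 1) : ℝ) / lucas (2 * (k + 1) + 1 - 1) +
        1 / Nat.fib (2 * (2 * (k + 1) + 1) - 2) =
        ((Nat.fib (2 * (k + 1) + 1 - 1) ^ 2 + 1 : ℕ) : ℝ) /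
          Nat.fib (2 * (2 * (k + 1) + 1 - 1)) := by
      rw [fib_div_lucas, show 2 * (2 * (k + 1) + 1) - 2 = 2 * (2 * (k + 1) + 1 - 1) by omega,
        ← add_div]
      push_cast
      rfl
    rw [show (2 * (k + 1) + 1 - 1) / 2 - 1 = k by omega, h3, Nat.fib_one, one_pow,
      show 2 * k + 1 + 1 = 2 * (k + 1) + 1 - 1 by omega, ← h4] at h1
    rw [show (2 * (k + 1) + 1 + 1) / 2 - 1 = k + 1 by omega, mul_comm (Nat.fib _), h3, Nat.fib_one, one_pow,
      show 2 * k + 1 + 1 = 2 * (k + 1) + 1 - 1 by omega, ← h4] at h2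
    refine ⟨h1, h2, hbound ?_ ?_ h1⟩
    · rw [h4, show (2 * (k + 1) + 1) % 2 = 1 by omega]
    · simp [vertexLabelled, Fin.ext_iff]
      omega
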